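/- Let $A=(a_{ij})\in\mathbb R^{n\times n}$ be generalised diagonally dominant, i.e. there is a diagonal $D=\mathrm{diag}(d_i)$ with all $d_i>0$ such that $M=D^{-1}AD$ satisfies $m_{ii}>\sum_{j\ne i}|m_{ij}|$ and $m_{ii}>0$ for all $i$. Let $b\in\mathbb R^n$ and $x^\star=A^{-1}b$. Let $G$ be the undirected graph on $\{1,\dots,n\}$ in which distinct $i,j$ are adjacent iff $a_{ij}\neq0$ or $a_{ji}\ne 0$, and let $N_i$ be the set of neighbours of $i$. The message-passing algorithm starts from $a^{(0)}_{i\to j}=a_{ii}$, $b^{(0)}_{i\to j}=b_i$ and computes, for $k\ge1$, every $i$ and every $j\in N_i$, $$a_i^{(k)}=a_{ii}-\sum_{v\in N_i}\frac{a_{vi}a_{iv}}{a_{v\to i}^{(k-1)}},\quad b_i^{(k)}=b_i-\sum_{v\in N_i}\frac{a_{iv}b_{v\to i}^{(k-1)}}{a_{v\to i}^{(k-1)}},\quad x_i^{(k)}=\frac{b_i^{(k)}}{a_i^{(k)}},$$ $$a_{i\to j}^{(k)}=a_i^{(k)}+\frac{a_{ji}a_{ij}}{a_{j\to i}^{(k-1)}},\quad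 b_{i\to j}^{(k)}=b_i^{(k)}+\frac{a_{ij}b_{j\to i}^{(k-1)}}{a_{j\to i}^{(k-1)}}.$$ For a norm $\|\cdot\|$ on $\mathbb R^n$ and a constant $C>0$, its asymptotic convergence rate is $$\lambda_\infty=\inf\Big\{\lambda>0:\ \limsup_{k\to\infty}\frac{\|x^{(k)}-x^\star\|}{\lambda^k}\le C\|x^\star\|\Big\},\qquad \inf\emptyset=\infty.$$ For $D=\mathrm{diag}(d_i)$ with all $d_i>0$ put $\varrho_i=\frac{\sum_{j\ne i}|a_{ij}|d_j}{a_{ii}d_i}$; $A$ is weakly $D$-scaled diagonally dominant if $a_{ii}>0$ for all $i$ and $\varrho_i\varrho_j<1$ for all adjacent $i,j$. A simple loop is a walk $i_0,i_1,\dots,i_k=i_0$ in $G$, $k\ge1$, with $i_{\ell+2}\ne i_\ell$ for $0\le\ell\le k-2$ and $i_\ell\neq i_0$ for $0<\ell<k$; its gain per node is $(\varrho_{i_0}\varrho_{i_1}\cdots\varrho_{i_{k-1}})^{1/k}$, and $\lambda_\star=\lambda_\star(D)$ is the largest gain per node over all simple loops ($\lambda_\star=0$ if $G$ is acyclic). Let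 $\bar R=(|r_{ij}|)$, where $R=(r_{ij})=I-A_d^{-1}A$ and $A_d=\mathrm{diag}(a_{ii})$, and let $\rho$ be the spectral radius of $\bar R$. Then, for every $b$, every norm and every $C>0$, $$\lambda_\infty\ \le\ \inf_{D}\lambda_\star(D)\ \le\ \rho,$$ where the infimum is over all positive diagonal $D$ for which $A$ is weakly $D$-scaled diagonally dominant. If moreover $\bar R$ is irreducible, then some such $D$ satisfies $\lambda_\star(D)\le\rho$. -/

import Mathlib

open scoped ENNReal

/-- Strict diagonal dominance by rows, with positive diagonal. -/
def IsDiagDominant {n : ℕ} (A : Matrix (Fin n) (Fin n) ℝ) : Prop :=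
  ∀ i, 0 < A i i ∧ ∑ j ∈ Finset.univ.filter (fun j => j ≠ i), |A i j| < A i i

/-- Generalised diagonal dominance: `D⁻¹ A D` is diagonally dominant for some positive
diagonal matrix `D = diag d`. -/
def IsGenDiagDominant {n : ℕ} (A : Matrix (Fin n) (Fin n) ℝ) : Prop :=
  ∃ d : Fin n → ℝ, (∀ i, 0 < d i) ∧
    IsDiagDominant ((Matrix.diagonal d)⁻¹ * A * Matrix.diagonal d)

/-- The induced graph: distinct nodes `i`, `j` are adjacent iff `a_ij ≠ 0` or `a_ji ≠ 0`. -/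
def inducedGraph {n : ℕ} (A : Matrix (Fin n) (Fin n) ℝ) : SimpleGraph (Fin n) where
  Adj i j := i ≠ j ∧ (A i j ≠ 0 ∨ A j i ≠ 0)
  symm := ⟨fun _ _ h => ⟨h.1.symm, h.2.symm⟩⟩
  loopless := ⟨fun _ h => h.1 rfl⟩

open Classical in
/-- The neighbouring set `N_i` of node `i`. -/
noncomputable def nbrs {n : ℕ} (A : Matrix (Fin n) (Fin n) ℝ) (i : Fin n) : Finset (Fin n) :=
  Finset.univ.filter (fun j => (inducedGraph A).Adj i j)

/-! ### The message-passing algorithm -/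

/-- `aMsg A k i j` is the message `a_{i → j}^{(k)}` (used only for `j ∈ N_i`). -/
noncomputable def aMsg {n : ℕ} (A : Matrix (Fin n) (Fin n) ℝ) : ℕ → Fin n → Fin n → ℝ
  | 0, i, _ => A i i
  | k + 1, i, j =>
      (A i i - ∑ v ∈ nbrs A i, A v i * A i v / aMsg A k v i) + A j i * A i j / aMsg A k j i

/-- `bMsg A b k i j` is the message `b_{i → j}^{(k)}` (used only for `j ∈ N_i`). -/
noncomputable def bMsg {n : ℕ} (A : Matrix (Fin n) (Fin n) ℝ) (b : Fin n → ℝ) :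
    ℕ → Fin n → Fin n → ℝ
  | 0, i, _ => b i
  | k + 1, i, j =>
      (b i - ∑ v ∈ nbrs A i, A i v * bMsg A b k v i / aMsg A k v i)
        + A i j * bMsg A b k j i / aMsg A k j i

/-- The estimate `x_i^{(k)} = b_i^{(k)} / a_i^{(k)}` of the algorithm for `k ≥ 1`
(with the value `b_i / a_ii` at `k = 0`, before the first iteration). -/
noncomputable def xIter {n : ℕ} (A : Matrix (Fin n) (Fin n) ℝ) (b : Fin n → ℝ) :
    ℕ → Fin n → ℝ
  | 0, i => b i / A i i
  | k + 1, i =>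
      (b i - ∑ v ∈ nbrs A i, A i v * bMsg A b k v i / aMsg A k v i)
        / (A i i - ∑ v ∈ nbrs A i, A v i * A i v / aMsg A k v i)

/-- The solution `x⋆ = A⁻¹ b`. -/
noncomputable def xStar {n : ℕ} (A : Matrix (Fin n) (Fin n) ℝ) (b : Fin n → ℝ) : Fin n → ℝ :=
  Matrix.mulVec A⁻¹ b

/-- The asymptotic convergence rate `λ_∞`: the infimum of all `l > 0` with
`limsup_k ‖x^{(k)} - x⋆‖ / l^k ≤ C ‖x⋆‖`, measured in the norm `N`
(the infimum of the empty set being `∞`). -/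
noncomputable def asymptoticRate {n : ℕ} (A : Matrix (Fin n) (Fin n) ℝ) (b : Fin n → ℝ)
    (N : Seminorm ℝ (Fin n → ℝ)) (C : ℝ) : ℝ≥0∞ :=
  ⨅ (l : ℝ) (_ : 0 < l ∧
      Filter.limsup (fun k : ℕ => ENNReal.ofReal (N (xIter A b k - xStar A b) / l ^ k))
        Filter.atTop ≤ ENNReal.ofReal (C * N (xStar A b))),
    ENNReal.ofReal l

/-! ### Scaled diagonal dominance and loop gains -/

/-- `ϱ_i = (∑_{j ≠ i} |a_ij| d_j) / (a_ii d_i)`. -/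
noncomputable def scaledRatio {n : ℕ} (A : Matrix (Fin n) (Fin n) ℝ) (d : Fin n → ℝ)
    (i : Fin n) : ℝ :=
  (∑ j ∈ Finset.univ.filter (fun j => j ≠ i), |A i j| * d j) / (A i i * d i)

/-- `D = diag d` is positive and `A` is weakly `D`-scaled diagonally dominant. -/
def IsWeaklyScaledDD {n : ℕ} (A : Matrix (Fin n) (Fin n) ℝ) (d : Fin n → ℝ) : Prop :=
  (∀ i, 0 < d i) ∧ (∀ i, 0 < A i i) ∧
    ∀ i j, (inducedGraph A).Adj i j → scaledRatio A d i * scaledRatio A d j < 1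

/-- A simple loop at `i`: a non-reversal closed walk of positive length that returns to its base
point `i` only at its end. -/
structure IsSimpleLoop {n : ℕ} {G : SimpleGraph (Fin n)} {i : Fin n} (p : G.Walk i i) : Prop where
  pos : 0 < p.length
  nonreversal : ∀ l, l + 2 ≤ p.length → p.getVert (l + 2) ≠ p.getVert l
  base : ∀ l, 0 < l → l < p.length → p.getVert l ≠ i

/-- The gain per node `(ϱ_{i_0} ϱ_{i_1} ⋯ ϱ_{i_{k-1}})^{1/k}` of a closed walk
`i_0, i_1, …, i_k = i_0`. -/
noncomputable def gainPerNode {n : ℕ} (A : Matrix (Fin n) (Fin n) ℝ) (d : Fin n → ℝ)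
    {i : Fin n} (p : (inducedGraph A).Walk i i) : ℝ :=
  (∏ l ∈ Finset.range p.length, scaledRatio A d (p.getVert l)) ^ ((1 : ℝ) / (p.length : ℝ))

/-- The maximum loop gain per node `λ_⋆`: the largest gain per node of a simple loop
(`0` if the graph is acyclic). -/
noncomputable def maxLoopGain {n : ℕ} (A : Matrix (Fin n) (Fin n) ℝ) (d : Fin n → ℝ) : ℝ≥0∞ :=
  ⨆ (i : Fin n) (p : (inducedGraph A).Walk i i) (_ : IsSimpleLoop p),
    ENNReal.ofReal (gainPerNode A d p)

/-- The loop-gain bound: the infimum of `λ_⋆` over all positive diagonal `D = diag d` for which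
`A` is weakly `D`-scaled diagonally dominant (the infimum of the empty set being `∞`). -/
noncomputable def loopGainBound {n : ℕ} (A : Matrix (Fin n) (Fin n) ℝ) : ℝ≥0∞ :=
  ⨅ (d : Fin n → ℝ) (_ : IsWeaklyScaledDD A d), maxLoopGain A d

/-! ### The spectral radius -/

/-- `R̄ = (|r_ij|)` for `R = I - A_d⁻¹ A`, where `A_d` is the diagonal part of `A`. -/
noncomputable def absR {n : ℕ} (A : Matrix (Fin n) (Fin n) ℝ) : Matrix (Fin n) (Fin n) ℝ :=
  (1 - (Matrix.diagonal A.diag)⁻¹ * A).map (fun r => |r|)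

/-- The spectral radius `ρ` of `R̄`: the largest modulus of a complex eigenvalue. -/
noncomputable def rhoR {n : ℕ} (A : Matrix (Fin n) (Fin n) ℝ) : ℝ≥0∞ :=
  spectralRadius ℂ ((absR A).map (fun r : ℝ => (r : ℂ)))

/-! ### Bounds for message recursions on a graph -/

section Messages

variable {ι : Type*}

/-! Fix an admissible `d` and normalise the entries to weights `w i j = |a_ij| d_j / (a_ii d_i)`,
whose row sums are the ratios `ϱ_i`. For the exact solution `x`, the residual `b_{i→j} - a_{i→j} x_i
- a_ij x_j` obeys a homogeneous recursion: at `i → j` it becomes minus the sum, over the neighbours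
`v ≠ j` of `i`, of `a_iv` times the residual at `v → i` divided by `a_{v→i}`. The same sum over all
neighbours, divided by `-a_i`, is the error of the estimate.

A discrete maximum principle (`message_bounds`, `residual_bound`, `node_bound`) needs only `ϱ_i ϱ_j
< 1` along edges. It bounds the error by a constant times the largest product of ratios along a
non-reversal walk. Cutting such a walk at first returns splits off simple loops and leaves boundedly
many other nodes (`prod_nonreversal_le`), so the error is `O(l ^ k)` for every positive `l ≥ λ_⋆`.

For the comparison with `ρ`, note that `R̄ d ≤ l d` says exactly that every `ϱ_i ≤ l`, whence `λ_⋆ ≤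
l`. Positive vectors of this kind exist for each `l > ρ` (`exists_pos_mulVec_le`). A limit of them
serves `l = ρ`, and irreducibility keeps it positive. -/

lemma sum_mul_lt_one_of_mul_lt_one (s : Finset ι) (w r : ι → ℝ) (R : ℝ)
    (hw : ∀ v ∈ s, 0 ≤ w v) (hr : ∀ v ∈ s, 0 ≤ r v) (hs : ∑ v ∈ s, w v ≤ R)
    (h : ∀ v ∈ s, R * r v < 1) : ∑ v ∈ s, w v * r v < 1 := by
  rcases s.eq_empty_or_nonempty with rfl | hne
  · simp
  obtain ⟨m, hm, hmax⟩ := s.exists_max_image r hne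
  calc ∑ v ∈ s, w v * r v ≤ ∑ v ∈ s, w v * r m :=
        Finset.sum_le_sum fun v hv => mul_le_mul_of_nonneg_left (hmax v hv) (hw v hv)
    _ = (∑ v ∈ s, w v) * r m := by rw [Finset.sum_mul]
    _ ≤ R * r m := mul_le_mul_of_nonneg_right hs (hr m hm)
    _ < 1 := h m hm

variable [DecidableEq ι]

/-- Weights `w` on a graph given by symmetric neighbouring sets, whose row sums `r`
satisfy `r i * r j < 1` along edges. -/
structure IsWeaklyContractive (nb : ι → Finset ι) (w : ι → ι → ℝ) (r : ι → ℝ) : Prop where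
  symm : ∀ i j, j ∈ nb i → i ∈ nb j
  nonneg : ∀ i j, 0 ≤ w i j
  sum_eq : ∀ i, ∑ v ∈ nb i, w i v = r i
  mul_lt : ∀ i, ∀ j ∈ nb i, r i * r j < 1

/-- The largest product of row sums, times `X`, along non-reversal walks of length `k` that
start at `i` without stepping to `j`. -/
noncomputable def walkBound (nb : ι → Finset ι) (r : ι → ℝ) (X : ℝ) : ℕ → ι → ι → ℝ
  | 0, i, _ => r i * X
  | k + 1, i, j => r i * (insert 0 (((nb i).erase j).image fun v => walkBound nb r X k v i)).max'
      (Finset.insert_nonempty 0 _)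

variable {nb : ι → Finset ι} {w : ι → ι → ℝ} {r : ι → ℝ}

lemma walkBound_succ (nb : ι → Finset ι) (r : ι → ℝ) (X : ℝ) (k : ℕ) (i j : ι) :
    ∃ g, 0 ≤ g ∧ walkBound nb r X (k + 1) i j = r i * g ∧
      (∀ v ∈ (nb i).erase j, walkBound nb r X k v i ≤ g) ∧
      (g = 0 ∨ ∃ v ∈ (nb i).erase j, g = walkBound nb r X k v i) := by
  set s := ((nb i).erase j).image fun v => walkBound nb r X k v i with hs
  refine ⟨(insert 0 s).max' (Finset.insert_nonempty _ _), ?_, rfl, fun v hv => ?_, ?_⟩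
  · exact Finset.le_max' _ _ (Finset.mem_insert_self 0 s)
  · have hvs : walkBound nb r X k v i ∈ s := Finset.mem_image_of_mem _ hv
    exact Finset.le_max' _ _ (Finset.mem_insert_of_mem hvs)
  · rcases Finset.mem_insert.1 (Finset.max'_mem (insert 0 s) (Finset.insert_nonempty _ _))
      with h | h
    · exact Or.inl h
    · obtain ⟨v, hv, h⟩ := Finset.mem_image.1 h
      exact Or.inr ⟨v, hv, h.symm⟩

namespace IsWeaklyContractive

variable (h : IsWeaklyContractive nb w r)
include h

omit [DecidableEq ι] in
lemma ratio_nonneg (i : ι) : 0 ≤ r i := by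
  rw [← h.sum_eq]; exact Finset.sum_nonneg fun v _ => h.nonneg i v

lemma sum_erase_add {i j : ι} (hj : j ∈ nb i) : ∑ v ∈ (nb i).erase j, w i v + w i j = r i := by
  rw [Finset.sum_erase_add _ _ hj, h.sum_eq]

omit [DecidableEq ι] in
lemma sum_mul_ratio_lt_one {i : ι} {s : Finset ι} (hs : s ⊆ nb i) :
    ∑ v ∈ s, w i v * r v < 1 := by
  refine sum_mul_lt_one_of_mul_lt_one s (w i) r (r i) (fun v _ => h.nonneg i v)
    (fun v _ => h.ratio_nonneg v) ?_ (fun v hv => h.mul_lt i v (hs hv))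
  rw [← h.sum_eq]
  exact Finset.sum_le_sum_of_subset_of_nonneg hs fun v _ _ => h.nonneg i v

omit [DecidableEq ι] in
lemma sum_div_le {α : ℕ → ι → ι → ℝ} {k : ℕ} {i : ι} {s : Finset ι}
    (hk : ∀ v ∈ s, 0 < α k v i ∧ w v i ≤ r v * α k v i) :
    ∑ v ∈ s, w i v * w v i / α k v i ≤ ∑ v ∈ s, w i v * r v := by
  refine Finset.sum_le_sum fun v hv => ?_
  obtain ⟨hp, hle⟩ := hk v hv
  rw [mul_div_assoc]
  exact mul_le_mul_of_nonneg_left ((div_le_iff₀ hp).2 hle) (h.nonneg i v)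

variable {α : ℕ → ι → ι → ℝ} (hα0 : ∀ i j, j ∈ nb i → α 0 i j = 1)
  (hα : ∀ k i j, j ∈ nb i →
    1 - ∑ v ∈ (nb i).erase j, w i v * w v i / α k v i ≤ α (k + 1) i j)
include hα0 hα

/-- Both claims must be carried together: `w v i / α k v i ≤ r v` for the incoming messages keeps
the next denominator positive, and the same estimate multiplied by `r i` restores the second claim.
-/
lemma message_bounds (k : ℕ) :
    ∀ i j, j ∈ nb i → 0 < α k i j ∧ w i j ≤ r i * α k i j := by
  induction k with
  | zero =>
    intro i j hj
    rw [hα0 i j hj, mul_one, ← h.sum_eq]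
    exact ⟨one_pos, Finset.single_le_sum (f := w i) (fun v _ => h.nonneg i v) hj⟩
  | succ k ih =>
    intro i j hj
    have hsub := Finset.erase_subset j (nb i)
    have h1 := h.sum_div_le (k := k) (s := (nb i).erase j) fun v hv => ih v i (h.symm i v (hsub hv))
    have h2 := h.sum_mul_ratio_lt_one hsub
    have h3 := hα k i j hj
    refine ⟨by linarith, ?_⟩
    -- Termwise `r i * r v ≤ 1`; what is then left of the row sum `r i` is exactly `w i j`.
    have h4 : r i * ∑ v ∈ (nb i).erase j, w i v * r v ≤ ∑ v ∈ (nb i).erase j, w i v := by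
      rw [Finset.mul_sum]
      refine Finset.sum_le_sum fun v hv => ?_
      have := mul_le_mul_of_nonneg_left (h.mul_lt i v (hsub hv)).le (h.nonneg i v)
      linarith
    have h5 := mul_le_mul_of_nonneg_left
      (show 1 - ∑ v ∈ (nb i).erase j, w i v * r v ≤ α (k + 1) i j by linarith)
      (h.ratio_nonneg i)
    have h6 := h.sum_erase_add hj
    linarith

variable {η : ℕ → ι → ι → ℝ} {X : ℝ}

/-- A supersolution bound: if each subtree is dominated at level `g`, so is the node. -/
lemma sum_le_of_forall_le {k : ℕ} {i : ι} {s : Finset ι} (hs : s ⊆ nb i) {g : ℝ}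
    (hg : ∀ v ∈ s, w v i * (r i * g) + η k v i ≤ α k v i * g) :
    ∑ v ∈ s, w i v * η k v i / α k v i
      -- The subtracted term is the amount by which the lower bound for the denominator, multiplied
      -- by `r i * g`, falls short of `r i * g`, so the two cancel when compared.
      ≤ ∑ v ∈ s, w i v * g - r i * g * ∑ v ∈ s, w i v * w v i / α k v i := by
  rw [Finset.mul_sum, ← Finset.sum_sub_distrib]
  refine Finset.sum_le_sum fun v hv => ?_
  have hp := (h.message_bounds hα0 hα k v i (h.symm i v (hs hv))).1
  have h1 : η k v i / α k v i ≤ g - w v i * (r i * g) / α k v i := by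
    rw [div_le_iff₀ hp, sub_mul, div_mul_cancel₀ _ hp.ne']
    have := hg v hv
    linarith
  have h2 := mul_le_mul_of_nonneg_left h1 (h.nonneg i v)
  calc w i v * η k v i / α k v i = w i v * (η k v i / α k v i) := by ring
    _ ≤ _ := h2
    _ = _ := by ring

variable (hη0 : ∀ i j, j ∈ nb i → η 0 i j ≤ ∑ v ∈ (nb i).erase j, w i v * X)
  (hη : ∀ k i j, j ∈ nb i →
    η (k + 1) i j ≤ ∑ v ∈ (nb i).erase j, w i v * η k v i / α k v i)
include hη0 hη

/-- The maximum principle. Here `p` stands for a bound on the value at the receiver `j`, and the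
claim bounds the value that the subtree behind `i` then produces at `i`. It is quantified over all
`p` so that the induction can feed `r i * g`, the bound at `i`, to each child `v`; there `r v * (r i
* g) ≤ g`. -/
lemma residual_bound (k : ℕ) : ∀ i j, j ∈ nb i → ∀ p, 0 ≤ p →
    w i j * p + η k i j ≤ α k i j * max (r i * p) (walkBound nb r X k i j) := by
  induction k with
  | zero =>
    intro i j hj p hp
    have h1 := hη0 i j hj
    rw [hα0 i j hj, one_mul, walkBound, ← mul_max_of_nonneg _ _ (h.ratio_nonneg i),
      ← h.sum_erase_add hj, add_mul]
    rw [← Finset.sum_mul] at h1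
    have h2 := mul_le_mul_of_nonneg_left (le_max_left p X) (h.nonneg i j)
    have h3 := mul_le_mul_of_nonneg_left (le_max_right p X)
      (Finset.sum_nonneg fun v (_ : v ∈ (nb i).erase j) => h.nonneg i v)
    linarith
  | succ k ih =>
    intro i j hj p hp
    obtain ⟨g₀, hg0, hgeq, hgle, -⟩ := walkBound_succ nb r X k i j
    have hsub := Finset.erase_subset j (nb i)
    rw [hgeq, ← mul_max_of_nonneg _ _ (h.ratio_nonneg i)]
    set g := max p g₀ with hgdef
    have hg : 0 ≤ g := hp.trans (le_max_left _ _)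
    have hrg : 0 ≤ r i * g := mul_nonneg (h.ratio_nonneg i) hg
    have key : ∀ v ∈ (nb i).erase j, w v i * (r i * g) + η k v i ≤ α k v i * g := by
      intro v hv
      have hvi := h.symm i v (hsub hv)
      refine (ih v i hvi (r i * g) hrg).trans
        (mul_le_mul_of_nonneg_left (max_le ?_ ((hgle v hv).trans (le_max_right _ _)))
          (h.message_bounds hα0 hα k v i hvi).1.le)
      have := mul_le_mul_of_nonneg_right (h.mul_lt i v (hsub hv)).le hg
      linarith
    have h1 := h.sum_le_of_forall_le hα0 hα hsub key
    have h2 := hη k i j hj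
    have h3 := mul_le_mul_of_nonneg_right (hα k i j hj) hrg
    have h4 := mul_le_mul_of_nonneg_left (le_max_left p g₀) (h.nonneg i j)
    have h5 := h.sum_erase_add hj
    rw [← Finset.sum_mul] at h1
    rw [← hgdef] at h4
    have h6 : r i * g = (∑ v ∈ (nb i).erase j, w i v) * g + w i j * g := by
      rw [← h5]; ring
    linarith

/-- The bound on the quotient `e / a` formed at a node from all its incoming messages. -/
lemma node_bound {k : ℕ} {i : ι} {a e g : ℝ} (hg : 0 ≤ g)
    (hgle : ∀ v ∈ nb i, walkBound nb r X k v i ≤ g)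
    (ha : 1 - ∑ v ∈ nb i, w i v * w v i / α k v i ≤ a)
    (he : e ≤ ∑ v ∈ nb i, w i v * η k v i / α k v i) :
    0 < a ∧ e ≤ a * (r i * g) := by
  have hrg : 0 ≤ r i * g := mul_nonneg (h.ratio_nonneg i) hg
  have hmb := fun v (hv : v ∈ nb i) => h.message_bounds hα0 hα k v i (h.symm i v hv)
  have key : ∀ v ∈ nb i, w v i * (r i * g) + η k v i ≤ α k v i * g := by
    intro v hv
    refine (h.residual_bound hα0 hα hη0 hη k v i (h.symm i v hv) (r i * g) hrg).trans
      (mul_le_mul_of_nonneg_left (max_le ?_ (hgle v hv)) (hmb v hv).1.le)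
    have := mul_le_mul_of_nonneg_right (h.mul_lt i v hv).le hg
    linarith
  have h1 := h.sum_le_of_forall_le hα0 hα subset_rfl key
  have h2 := h.sum_div_le hmb
  have h3 := h.sum_mul_ratio_lt_one (subset_refl (nb i))
  refine ⟨by linarith, ?_⟩
  have h4 := mul_le_mul_of_nonneg_right ha hrg
  rw [← Finset.sum_mul, h.sum_eq] at h1
  linarith

end IsWeaklyContractive

/-! ### Products along non-reversal walks -/

/-- The first `k` steps of the sequence `p` form a non-reversal walk. -/
structure IsNonreversal (nb : ι → Finset ι) (p : ℕ → ι) (k : ℕ) : Prop where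
  adj : ∀ l < k, p (l + 1) ∈ nb (p l)
  ne : ∀ l, l + 2 ≤ k → p (l + 2) ≠ p l

omit [DecidableEq ι] in
lemma IsNonreversal.shift {p : ℕ → ι} {k : ℕ} (h : IsNonreversal nb p k) {m l : ℕ}
    (hm : l + m ≤ k) : IsNonreversal nb (fun t => p (l + t)) m :=
  ⟨fun t ht => h.adj (l + t) (by omega), fun t ht => h.ne (l + t) (by omega)⟩

/-- The maxima are attained, so unrolling the recursion traces out one optimal walk. The value `0`
arises at dead ends, where no walk can be continued. -/
lemma exists_walkBound_eq (nb : ι → Finset ι) (r : ι → ℝ) (X : ℝ) (k : ℕ) (i j : ι) :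
    walkBound nb r X k i j = 0 ∨ ∃ p, IsNonreversal nb p k ∧ p 0 = i ∧ (0 < k → p 1 ≠ j) ∧
      walkBound nb r X k i j = (∏ l ∈ Finset.range (k + 1), r (p l)) * X := by
  induction k generalizing i j with
  | zero =>
    exact Or.inr ⟨fun _ => i, ⟨by simp, by simp⟩, rfl, by simp, by simp [walkBound]⟩
  | succ k ih =>
    obtain ⟨g, -, hg, -, h0 | ⟨v, hv, hgv⟩⟩ := walkBound_succ nb r X k i j
    · left; rw [hg, h0, mul_zero]
    rcases ih v i with h1 | ⟨p, hp, hp0, hp1, hpe⟩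
    · left; rw [hg, hgv, h1, mul_zero]
    right
    refine ⟨fun t => Nat.casesOn t i p, ⟨?_, ?_⟩, rfl, fun _ => ?_, ?_⟩
    · rintro (_ | l) hl
      · simpa [hp0] using Finset.mem_of_mem_erase hv
      · exact hp.adj l (by omega)
    · rintro (_ | l) hl
      · exact hp1 (by omega)
      · exact hp.ne l (by omega)
    · simpa [hp0] using Finset.ne_of_mem_erase hv
    · rw [hg, hgv, hpe, Finset.prod_range_succ' _ (k + 1)]
      change _ = _ * r i * X
      ring

/-- If the product along every simple loop of length `m` is at most `l ^ m`, then the product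
along every non-reversal walk of length `k` is at most a constant times `l ^ (k + 1)`. -/
lemma prod_nonreversal_le {r : ι → ℝ} (hr : ∀ i, 0 ≤ r i) {l K : ℝ} (hl : 0 < l) (hK : 1 ≤ K)
    (hrK : ∀ i, r i ≤ K * l)
    (hloop : ∀ p m, 0 < m → IsNonreversal nb p m → p m = p 0 →
      (∀ t, 0 < t → t < m → p t ≠ p 0) → ∏ t ∈ Finset.range m, r (p t) ≤ l ^ m)
    (k : ℕ) : ∀ (S : Finset ι) (p : ℕ → ι), IsNonreversal nb p k → (∀ t ≤ k, p t ∈ S) →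
      ∏ t ∈ Finset.range (k + 1), r (p t) ≤ K ^ S.card * l ^ (k + 1) := by
  induction k using Nat.strong_induction_on with
  | _ k ih =>
  intro S p hp hS
  -- If the start recurs, the segment up to its first return is a simple loop and costs no factor
  -- `K`. Otherwise the start leaves `S` for good, at the price of one `K`; this happens at most
  -- `S.card` times.
  by_cases hret : ∃ m, 0 < m ∧ m ≤ k ∧ p m = p 0
  · classical
    let m := Nat.find hret
    obtain ⟨hm0, hmk, hm⟩ : 0 < m ∧ m ≤ k ∧ p m = p 0 := Nat.find_spec hret
    have hmin : ∀ t, 0 < t → t < m → p t ≠ p 0 := fun t h0 ht he =>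
      Nat.find_min hret ht ⟨h0, by omega, he⟩
    have h1 := hloop p m hm0 ⟨fun t ht => hp.adj t (by omega), fun t ht => hp.ne t (by omega)⟩
      hm hmin
    have h2 := ih (k - m) (by omega) S (fun t => p (m + t)) (hp.shift (by omega))
      (fun t ht => hS _ (by omega))
    have hsplit : k + 1 = m + (k - m + 1) := by omega
    rw [hsplit, Finset.prod_range_add, pow_add]
    calc _ ≤ l ^ m * (K ^ S.card * l ^ (k - m + 1)) :=
          mul_le_mul h1 h2 (Finset.prod_nonneg fun _ _ => hr _) (by positivity)
      _ = _ := by ring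
  · push Not at hret
    have hcard : (S.erase (p 0)).card + 1 = S.card :=
      Finset.card_erase_add_one (hS 0 (Nat.zero_le _))
    rcases k with _ | k
    · simp only [zero_add, Finset.prod_range_one, pow_one]
      refine (hrK _).trans (mul_le_mul_of_nonneg_right ?_ hl.le)
      exact le_self_pow₀ hK (by omega)
    · have h2 := ih k (by omega) (S.erase (p 0)) (fun t => p (1 + t)) (hp.shift (by omega))
        (fun t ht => Finset.mem_erase.2 ⟨hret _ (by omega) (by omega), hS _ (by omega)⟩)
      rw [Finset.prod_range_succ' _ (k + 1), ← hcard]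
      simp only [add_comm 1] at h2
      calc _ ≤ (K ^ (S.erase (p 0)).card * l ^ (k + 1)) * (K * l) :=
            mul_le_mul h2 (hrK _) (hr _) (by positivity)
        _ = _ := by ring

lemma walkBound_le [Fintype ι] {r : ι → ℝ} (hr : ∀ i, 0 ≤ r i) {l K X : ℝ} (hl : 0 < l)
    (hK : 1 ≤ K) (hrK : ∀ i, r i ≤ K * l) (hX : 0 ≤ X)
    (hloop : ∀ p m, 0 < m → IsNonreversal nb p m → p m = p 0 →
      (∀ t, 0 < t → t < m → p t ≠ p 0) → ∏ t ∈ Finset.range m, r (p t) ≤ l ^ m)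
    (k : ℕ) (i j : ι) :
    walkBound nb r X k i j ≤ K ^ Fintype.card ι * l ^ (k + 1) * X := by
  rcases exists_walkBound_eq nb r X k i j with h | ⟨p, hp, -, -, h⟩
  · rw [h]; positivity
  · rw [h]
    exact mul_le_mul_of_nonneg_right (prod_nonreversal_le hr hl hK hrK hloop k Finset.univ p hp
      fun _ _ => Finset.mem_univ _) hX

end Messages

/-! ### Convergence of the message-passing algorithm -/

section Convergence

variable {n : ℕ} {A : Matrix (Fin n) (Fin n) ℝ} {d : Fin n → ℝ}

lemma mem_nbrs {i j : Fin n} : j ∈ nbrs A i ↔ (inducedGraph A).Adj i j := by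
  simp [nbrs]

lemma nbrs_symm {i j : Fin n} (h : j ∈ nbrs A i) : i ∈ nbrs A j :=
  mem_nbrs.2 (mem_nbrs.1 h).symm

lemma sum_nbrs_eq (i : Fin n) (f : Fin n → ℝ) (hf : ∀ j, A i j = 0 → f j = 0) :
    ∑ j ∈ nbrs A i, f j = ∑ j ∈ Finset.univ.filter (fun j => j ≠ i), f j := by
  refine Finset.sum_subset (fun j hj => ?_) fun j hj hj' => hf j ?_
  · simpa using (mem_nbrs.1 hj).1.symm
  · by_contra h
    exact hj' (mem_nbrs.2 ⟨(by simpa using hj : j ≠ i).symm, Or.inl h⟩)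

/-- The off-diagonal entries of the scaled matrix, relative to its diagonal. -/
noncomputable def scaledWeight (A : Matrix (Fin n) (Fin n) ℝ) (d : Fin n → ℝ)
    (i j : Fin n) : ℝ :=
  |A i j| * d j / (A i i * d i)

lemma IsWeaklyScaledDD.isWeaklyContractive (h : IsWeaklyScaledDD A d) :
    IsWeaklyContractive (nbrs A) (scaledWeight A d) (scaledRatio A d) where
  symm _ _ := nbrs_symm
  nonneg i j := by
    have h1 := h.1 i
    have h2 := h.1 j
    have h3 := h.2.1 i
    unfold scaledWeight
    positivity
  sum_eq i := by
    rw [sum_nbrs_eq i _ fun j hj => by simp [scaledWeight, hj], scaledRatio, Finset.sum_div]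
    rfl
  mul_lt i j hj := h.2.2 i j (mem_nbrs.1 hj)

/-- The normalised size of the messages `a_{i → j}`. -/
noncomputable def relMsg (A : Matrix (Fin n) (Fin n) ℝ) (k : ℕ) (i j : Fin n) : ℝ :=
  |aMsg A k i j| / A i i

/-- The residual of the messages to `j` at a vector `x`. -/
noncomputable def msgResidual (A : Matrix (Fin n) (Fin n) ℝ) (b x : Fin n → ℝ) (k : ℕ)
    (i j : Fin n) : ℝ :=
  bMsg A b k i j - aMsg A k i j * x i - A i j * x j

/-- The normalised size of the residual of the messages. -/
noncomputable def relResidual (A : Matrix (Fin n) (Fin n) ℝ) (d b x : Fin n → ℝ) (k : ℕ)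
    (i j : Fin n) : ℝ :=
  |msgResidual A b x k i j| / (A i i * d i)

lemma aMsg_succ {k : ℕ} {i j : Fin n} (hj : j ∈ nbrs A i) :
    aMsg A (k + 1) i j = A i i - ∑ v ∈ (nbrs A i).erase j, A v i * A i v / aMsg A k v i := by
  rw [aMsg, ← Finset.sum_erase_add _ _ hj]
  ring

lemma bMsg_succ {b : Fin n → ℝ} {k : ℕ} {i j : Fin n} (hj : j ∈ nbrs A i) :
    bMsg A b (k + 1) i j
      = b i - ∑ v ∈ (nbrs A i).erase j, A i v * bMsg A b k v i / aMsg A k v i := by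
  rw [bMsg, ← Finset.sum_erase_add _ _ hj]
  ring

/-- The scaling `d` cancels in `w i v * w v i`. Signs of the products `a_vi a_iv` are immaterial,
since only a lower bound is needed. -/
lemma one_sub_sum_le_abs_div (h : IsWeaklyScaledDD A d) (k : ℕ) (i : Fin n)
    (s : Finset (Fin n)) :
    1 - ∑ v ∈ s, scaledWeight A d i v * scaledWeight A d v i / relMsg A k v i
      ≤ |A i i - ∑ v ∈ s, A v i * A i v / aMsg A k v i| / A i i := by
  have hi := h.2.1 i
  rw [le_div_iff₀ hi, sub_mul, one_mul, Finset.sum_mul]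
  refine le_trans (sub_le_sub_left ?_ _) (le_abs_self _)
  refine Finset.sum_le_sum fun v _ => (le_abs_self _).trans (le_of_eq ?_)
  have hv := (h.2.1 v).ne'
  have hdi := (h.1 i).ne'
  have hdv := (h.1 v).ne'
  rw [abs_div, abs_mul, scaledWeight, scaledWeight, relMsg]
  field_simp

lemma sum_eq_of_mulVec_eq {b x : Fin n → ℝ} (hx : A.mulVec x = b) (i : Fin n) :
    A i i * x i + ∑ v ∈ nbrs A i, A i v * x v = b i := by
  rw [sum_nbrs_eq i _ fun j hj => by simp [hj], ← hx, Finset.filter_ne']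
  exact Finset.add_sum_erase _ (fun j => A i j * x j) (Finset.mem_univ i)

/-- Substitute `b_{v→i} = residual + a_{v→i} x_v + a_vi x_i`: the `x_i` terms cancel. When `A x =
b`, the part of the right side without residuals equals `a_ij x_j` for `s = N_i \ {j}` and `0` for
`s = N_i`. -/
lemma sub_sum_sub_eq {b x : Fin n → ℝ} {k : ℕ} {i : Fin n} {s : Finset (Fin n)}
    (hs : ∀ v ∈ s, aMsg A k v i ≠ 0) :
    (b i - ∑ v ∈ s, A i v * bMsg A b k v i / aMsg A k v i)
        - (A i i - ∑ v ∈ s, A v i * A i v / aMsg A k v i) * x i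
      = b i - A i i * x i - ∑ v ∈ s, A i v * x v
        - ∑ v ∈ s, A i v * msgResidual A b x k v i / aMsg A k v i := by
  have : ∑ v ∈ s, A i v * bMsg A b k v i / aMsg A k v i
      = ∑ v ∈ s, A v i * A i v / aMsg A k v i * x i + ∑ v ∈ s, A i v * x v
        + ∑ v ∈ s, A i v * msgResidual A b x k v i / aMsg A k v i := by
    rw [← Finset.sum_add_distrib, ← Finset.sum_add_distrib]
    refine Finset.sum_congr rfl fun v hv => ?_
    have := hs v hv
    rw [msgResidual]
    field_simp
    ring
  rw [this, sub_mul, Finset.sum_mul]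
  ring

lemma abs_sum_residual_le (h : IsWeaklyScaledDD A d) (b x : Fin n → ℝ) (k : ℕ) (i : Fin n)
    (s : Finset (Fin n)) :
    |∑ v ∈ s, A i v * msgResidual A b x k v i / aMsg A k v i| / (A i i * d i)
      ≤ ∑ v ∈ s, scaledWeight A d i v * relResidual A d b x k v i / relMsg A k v i := by
  have hi : 0 < A i i * d i := mul_pos (h.2.1 i) (h.1 i)
  rw [div_le_iff₀ hi, Finset.sum_mul]
  refine (Finset.abs_sum_le_sum_abs _ _).trans (Finset.sum_le_sum fun v _ => le_of_eq ?_)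
  have hv := (h.2.1 v).ne'
  have hdi := (h.1 i).ne'
  have hdv := (h.1 v).ne'
  have hii := (h.2.1 i).ne'
  rw [abs_div, abs_mul, scaledWeight, relResidual, relMsg]
  field_simp

/-- The error of the estimates is bounded by products of the ratios along non-reversal walks. -/
lemma abs_xIter_sub_le (h : IsWeaklyScaledDD A d) {b x : Fin n → ℝ} (hx : A.mulVec x = b)
    {X : ℝ} (hX : ∀ v, |x v| ≤ X * d v) (k : ℕ) (i : Fin n) {g : ℝ} (hg : 0 ≤ g)
    (hgle : ∀ v ∈ nbrs A i, walkBound (nbrs A) (scaledRatio A d) X k v i ≤ g) :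
    |xIter A b (k + 1) i - x i| ≤ d i * (scaledRatio A d i * g) := by
  have hc := h.isWeaklyContractive
  have hα0 : ∀ i j, j ∈ nbrs A i → relMsg A 0 i j = 1 := fun i j _ => by
    rw [relMsg, aMsg, abs_of_pos (h.2.1 i), div_self (h.2.1 i).ne']
  have hα : ∀ k i j, j ∈ nbrs A i → 1 - ∑ v ∈ (nbrs A i).erase j,
      scaledWeight A d i v * scaledWeight A d v i / relMsg A k v i ≤ relMsg A (k + 1) i j :=
    fun k i j hj => by
      rw [relMsg, aMsg_succ hj]
      exact one_sub_sum_le_abs_div h k i _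
  -- No message used as a denominator vanishes, so the default value of division by zero never
  -- enters.
  have hne : ∀ k i, ∀ v ∈ nbrs A i, aMsg A k v i ≠ 0 := fun k i v hv h0 => by
    have := (hc.message_bounds hα0 hα k v i (nbrs_symm hv)).1
    simp [relMsg, h0] at this
  have hη0 : ∀ i j, j ∈ nbrs A i → relResidual A d b x 0 i j
      ≤ ∑ v ∈ (nbrs A i).erase j, scaledWeight A d i v * X := fun i j hj => by
    have hii := h.2.1 i
    have hdi := h.1 i
    have h1 : msgResidual A b x 0 i j = ∑ v ∈ (nbrs A i).erase j, A i v * x v := by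
      have h2 := sum_eq_of_mulVec_eq hx i
      rw [← Finset.sum_erase_add _ _ hj] at h2
      rw [msgResidual, bMsg, aMsg]
      linarith
    rw [relResidual, h1, div_le_iff₀ (mul_pos hii hdi), Finset.sum_mul]
    refine (Finset.abs_sum_le_sum_abs _ _).trans (Finset.sum_le_sum fun v _ => ?_)
    rw [abs_mul]
    refine (mul_le_mul_of_nonneg_left (hX v) (abs_nonneg _)).trans (le_of_eq ?_)
    rw [scaledWeight]
    field_simp
  have hη : ∀ k i j, j ∈ nbrs A i → relResidual A d b x (k + 1) i j
      ≤ ∑ v ∈ (nbrs A i).erase j,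
        scaledWeight A d i v * relResidual A d b x k v i / relMsg A k v i := fun k i j hj => by
    have h1 : msgResidual A b x (k + 1) i j = -∑ v ∈ (nbrs A i).erase j,
        A i v * msgResidual A b x k v i / aMsg A k v i := by
      have h2 := sum_eq_of_mulVec_eq hx i
      rw [← Finset.sum_erase_add _ _ hj] at h2
      rw [msgResidual, bMsg_succ hj, aMsg_succ hj,
        sub_sum_sub_eq fun v hv => hne k i v (Finset.mem_of_mem_erase hv)]
      linarith
    rw [relResidual, h1, abs_neg]
    exact abs_sum_residual_le h b x k i _
  obtain ⟨hpos, hle⟩ := hc.node_bound hα0 hα hη0 hη hg hgle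
    (one_sub_sum_le_abs_div h k i (nbrs A i)) (abs_sum_residual_le h b x k i (nbrs A i))
  have hden : A i i - ∑ v ∈ nbrs A i, A v i * A i v / aMsg A k v i ≠ 0 := fun h0 => by
    simp [h0] at hpos
  have hii := h.2.1 i
  have hdi := h.1 i
  rw [xIter, div_sub' hden, abs_div, div_le_iff₀ (abs_pos.2 hden),
    sub_sum_sub_eq (hne k i)]
  have h2 := sum_eq_of_mulVec_eq hx i
  rw [← h2, show ∀ a s t : ℝ, a + s - a - s - t = -t by intros; ring, abs_neg]
  rw [div_le_iff₀ (mul_pos hii hdi)] at hle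
  refine hle.trans (le_of_eq ?_)
  field_simp

lemma exists_walk_of_adj {V : Type*} {G : SimpleGraph V} (p : ℕ → V) (k : ℕ)
    (h : ∀ l < k, G.Adj (p l) (p (l + 1))) :
    ∃ q : G.Walk (p 0) (p k), q.length = k ∧ ∀ l ≤ k, q.getVert l = p l := by
  induction k generalizing p with
  | zero => exact ⟨.nil, rfl, fun l hl => by simp [Nat.le_zero.1 hl]⟩
  | succ k ih =>
    obtain ⟨q, hq, hv⟩ := ih (fun l => p (l + 1)) fun l hl => h (l + 1) (by omega)
    refine ⟨.cons (h 0 (by omega)) q, by simp [hq], ?_⟩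
    rintro (_ | l) hl
    · simp
    · simpa using hv l (by omega)

lemma scaledRatio_nonneg (h : IsWeaklyScaledDD A d) (i : Fin n) : 0 ≤ scaledRatio A d i :=
  h.isWeaklyContractive.ratio_nonneg i

lemma prod_loop_le (h : IsWeaklyScaledDD A d) {l : ℝ} (hl : 0 ≤ l)
    (hlt : maxLoopGain A d ≤ ENNReal.ofReal l) (p : ℕ → Fin n) (m : ℕ) (hm : 0 < m)
    (hp : IsNonreversal (nbrs A) p m) (hp0 : p m = p 0)
    (hbase : ∀ t, 0 < t → t < m → p t ≠ p 0) :
    ∏ t ∈ Finset.range m, scaledRatio A d (p t) ≤ l ^ m := by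
  obtain ⟨q, hq, hv⟩ := exists_walk_of_adj (G := inducedGraph A) p m
    fun l hl => mem_nbrs.1 (hp.adj l hl)
  let c : (inducedGraph A).Walk (p 0) (p 0) := q.copy rfl hp0
  have hcl : c.length = m := by simp [c, hq]
  have hcv : ∀ t ≤ m, c.getVert t = p t := fun t ht => by simp [c, hv t ht]
  have hc : IsSimpleLoop c := by
    refine ⟨by omega, fun t ht => ?_, fun t h0 ht => ?_⟩
    · rw [hcv _ (by omega), hcv _ (by omega)]
      exact hp.ne t (by omega)
    · rw [hcv _ (by omega)]
      exact hbase t h0 (by omega)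
  have hgain : gainPerNode A d c ≤ l := by
    rw [← ENNReal.ofReal_le_ofReal_iff hl]
    refine le_trans ?_ hlt
    exact le_iSup_of_le (p 0) (le_iSup₂_of_le (f := fun q (_ : IsSimpleLoop q) =>
      ENNReal.ofReal (gainPerNode A d q)) c hc le_rfl)
  have hprod : ∏ t ∈ Finset.range c.length, scaledRatio A d (c.getVert t)
      = ∏ t ∈ Finset.range m, scaledRatio A d (p t) := by
    rw [hcl]
    exact Finset.prod_congr rfl fun t ht => by rw [hcv t (Finset.mem_range.1 ht).le]
  have hnn : 0 ≤ ∏ t ∈ Finset.range m, scaledRatio A d (p t) :=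
    Finset.prod_nonneg fun _ _ => scaledRatio_nonneg h _
  rw [gainPerNode, hprod, hcl, one_div] at hgain
  have := pow_le_pow_left₀ (Real.rpow_nonneg hnn _) hgain m
  rwa [Real.rpow_inv_natCast_pow hnn hm.ne'] at this

/-- The estimates converge geometrically, at any rate that bounds the loop gains. -/
lemma exists_abs_xIter_sub_le (h : IsWeaklyScaledDD A d) {b x : Fin n → ℝ}
    (hx : A.mulVec x = b) {l : ℝ} (hl : 0 < l) (hlt : maxLoopGain A d ≤ ENNReal.ofReal l) :
    ∃ M, ∀ k i, |xIter A b (k + 1) i - x i| ≤ M * l ^ (k + 1) := by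
  have hr := scaledRatio_nonneg h
  -- Any bound on `|x v| / d v` would do for `X`, and any `K ≥ 1` with all ratios at most `K * l`;
  -- sums serve in place of maxima.
  set X := ∑ v, |x v| / d v with hXdef
  have hX0 : 0 ≤ X := Finset.sum_nonneg fun v _ => div_nonneg (abs_nonneg _) (h.1 v).le
  have hX : ∀ v, |x v| ≤ X * d v := fun v => by
    rw [← div_le_iff₀ (h.1 v)]
    exact Finset.single_le_sum (f := fun v => |x v| / d v)
      (fun v _ => div_nonneg (abs_nonneg _) (h.1 v).le) (Finset.mem_univ v)
  set K := 1 + ∑ v, scaledRatio A d v / l with hKdef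
  have hK0 : 0 ≤ ∑ v, scaledRatio A d v / l :=
    Finset.sum_nonneg fun v _ => div_nonneg (hr v) hl.le
  have hK : 1 ≤ K := by linarith
  have hrK : ∀ v, scaledRatio A d v ≤ K * l := fun v => by
    rw [← div_le_iff₀ hl]
    refine (Finset.single_le_sum (f := fun v => scaledRatio A d v / l)
      (fun v _ => div_nonneg (hr v) hl.le) (Finset.mem_univ v)).trans ?_
    linarith
  set g : ℕ → ℝ := fun k => K ^ Fintype.card (Fin n) * l ^ (k + 1) * X with hgdef
  have hg : ∀ k, 0 ≤ g k := fun k => by positivity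
  set M := ∑ i, d i * scaledRatio A d i with hM
  refine ⟨M * (K ^ Fintype.card (Fin n) * X), fun k i => ?_⟩
  calc |xIter A b (k + 1) i - x i| ≤ d i * (scaledRatio A d i * g k) :=
        abs_xIter_sub_le h hx hX k i (hg k) fun v _ =>
          walkBound_le hr hl hK hrK hX0 (prod_loop_le h hl.le hlt) k v i
    _ = d i * scaledRatio A d i * g k := by ring
    _ ≤ M * g k := by
        refine mul_le_mul_of_nonneg_right ?_ (hg k)
        exact Finset.single_le_sum (f := fun i => d i * scaledRatio A d i)
          (fun i _ => mul_nonneg (h.1 i).le (hr i)) (Finset.mem_univ i)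
    _ = _ := by rw [hgdef]; ring

lemma seminorm_le_of_forall_abs_le (N : Seminorm ℝ (Fin n → ℝ)) :
    ∃ c, 0 ≤ c ∧ ∀ y B, (∀ i, |y i| ≤ B) → N y ≤ c * B := by
  refine ⟨∑ i, N (Pi.single i 1), Finset.sum_nonneg fun i _ => apply_nonneg N _,
    fun y B hy => ?_⟩
  have hy' : y = ∑ i, y i • (Pi.single i 1 : Fin n → ℝ) := by
    simpa [← Pi.single_smul] using (Finset.univ_sum_single y).symm
  calc N y = N (∑ i, y i • (Pi.single i 1 : Fin n → ℝ)) := by rw [← hy']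
    _ ≤ ∑ i, N (y i • (Pi.single i 1 : Fin n → ℝ)) :=
        Finset.le_sum_of_subadditive N (map_zero N).le (map_add_le_add N) _ _
    _ = ∑ i, |y i| * N (Pi.single i 1) := by simp [map_smul_eq_mul]
    _ ≤ ∑ i, B * N (Pi.single i 1) := Finset.sum_le_sum fun i _ =>
        mul_le_mul_of_nonneg_right (hy i) (apply_nonneg N _)
    _ = _ := by rw [← Finset.mul_sum, mul_comm]

lemma asymptoticRate_le_maxLoopGain (h : IsWeaklyScaledDD A d) {b : Fin n → ℝ}
    (hx : A.mulVec (xStar A b) = b) (N : Seminorm ℝ (Fin n → ℝ)) (C : ℝ) :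
    asymptoticRate A b N C ≤ maxLoopGain A d := by
  refine le_of_forall_gt_imp_ge_of_dense fun t ht => ?_
  rcases eq_or_ne t ⊤ with rfl | hfin
  · exact le_top
  -- Convergence at the smaller rate `s` makes the limsup at rate `t` equal to `0`, so the constant
  -- `C` plays no role.
  obtain ⟨s, hs1, hs2⟩ := exists_between ht
  have hsfin : s ≠ ⊤ := (hs2.trans_le le_top).ne
  have hs0 : 0 < s.toReal := ENNReal.toReal_pos (ne_bot_of_gt hs1) hsfin
  have hst : s.toReal < t.toReal := (ENNReal.toReal_lt_toReal hsfin hfin).2 hs2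
  have ht0 : 0 < t.toReal := hs0.trans hst
  obtain ⟨M, hM⟩ := exists_abs_xIter_sub_le h hx hs0
    (hs1.le.trans_eq (ENNReal.ofReal_toReal hsfin).symm)
  obtain ⟨c, hc, hN⟩ := seminorm_le_of_forall_abs_le N
  refine (iInf₂_le t.toReal ⟨ht0, ?_⟩).trans_eq (ENNReal.ofReal_toReal hfin)
  have hlim : Filter.Tendsto
      (fun k : ℕ => N (xIter A b k - xStar A b) / t.toReal ^ k) Filter.atTop (nhds 0) := by
    have hgeo : Filter.Tendsto (fun k : ℕ => c * M * (s.toReal / t.toReal) ^ k)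
        Filter.atTop (nhds 0) := by
      simpa using (tendsto_pow_atTop_nhds_zero_of_lt_one (by positivity)
        ((div_lt_one ht0).2 hst)).const_mul (c * M)
    refine squeeze_zero' (Filter.Eventually.of_forall fun k =>
      div_nonneg (apply_nonneg N _) (by positivity)) ?_ hgeo
    filter_upwards [Filter.eventually_ge_atTop 1] with k hk
    obtain ⟨k, rfl⟩ := Nat.exists_eq_add_of_le' hk
    rw [div_pow, ← mul_div_assoc]
    refine div_le_div_of_nonneg_right ?_ (by positivity)
    rw [mul_assoc]
    exact hN _ _ fun i => hM k i
  have := (ENNReal.tendsto_ofReal hlim).limsup_eq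
  rw [this, ENNReal.ofReal_zero]
  exact zero_le

end Convergence

/-! ### Scalings from subinvariant vectors -/

section Scaling

variable {n : ℕ} {A : Matrix (Fin n) (Fin n) ℝ} {d : Fin n → ℝ}

lemma scaled_apply (hd : ∀ i, 0 < d i) (i j : Fin n) :
    ((Matrix.diagonal d)⁻¹ * A * Matrix.diagonal d) i j = A i j * d j / d i := by
  have hu : IsUnit d := Pi.isUnit_iff.2 fun i => (hd i).ne'.isUnit
  have : Ring.inverse d i = (d i)⁻¹ :=
    eq_inv_of_mul_eq_one_left (congrFun (Ring.inverse_mul_cancel d hu) i)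
  rw [Matrix.mul_diagonal, Matrix.inv_diagonal, Matrix.diagonal_mul, this]
  ring

lemma isDiagDominant_scaled_iff (hd : ∀ i, 0 < d i) :
    IsDiagDominant ((Matrix.diagonal d)⁻¹ * A * Matrix.diagonal d) ↔
      ∀ i, 0 < A i i ∧ scaledRatio A d i < 1 := by
  refine forall_congr' fun i => ?_
  simp only [scaled_apply hd, mul_div_cancel_right₀ _ (hd i).ne']
  refine and_congr_right fun hi => ?_
  rw [scaledRatio, div_lt_one (mul_pos hi (hd i)), ← div_lt_iff₀ (hd i), Finset.sum_div]
  simp only [abs_div, abs_mul, abs_of_pos (hd _)]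

lemma isUnit_det_of_isDiagDominant_scaled
    (h : IsDiagDominant ((Matrix.diagonal d)⁻¹ * A * Matrix.diagonal d)) : IsUnit A.det := by
  have h1 := det_ne_zero_of_sum_row_lt_diag
    (A := (Matrix.diagonal d)⁻¹ * A * Matrix.diagonal d) fun k => by
      have := (h k).2
      rw [Finset.filter_ne'] at this
      simpa only [Real.norm_eq_abs, abs_of_pos (h k).1] using this
  rw [Matrix.det_mul, Matrix.det_mul] at h1
  exact (right_ne_zero_of_mul (left_ne_zero_of_mul h1)).isUnit

lemma isWeaklyScaledDD_of_ratio_lt_one (hd : ∀ i, 0 < d i) (hA : ∀ i, 0 < A i i)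
    (h : ∀ i, scaledRatio A d i < 1) : IsWeaklyScaledDD A d := by
  refine ⟨hd, hA, fun i j _ => mul_lt_one_of_nonneg_of_lt_one_left ?_ (h i) (h j).le⟩
  exact div_nonneg (Finset.sum_nonneg fun j _ => mul_nonneg (abs_nonneg _) (hd j).le)
    (mul_pos (hA i) (hd i)).le

lemma maxLoopGain_le (h : IsWeaklyScaledDD A d) {l : ℝ} (hr : ∀ i, scaledRatio A d i ≤ l) :
    maxLoopGain A d ≤ ENNReal.ofReal l := by
  refine iSup_le fun i => iSup₂_le fun p hp => ENNReal.ofReal_le_ofReal ?_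
  have hl : 0 ≤ l := (scaledRatio_nonneg h i).trans (hr i)
  have h1 : ∏ t ∈ Finset.range p.length, scaledRatio A d (p.getVert t) ≤ l ^ p.length := by
    simpa using Finset.prod_le_prod (fun t _ => scaledRatio_nonneg h (p.getVert t))
      (s := Finset.range p.length) fun t _ => hr (p.getVert t)
  rw [gainPerNode]
  refine (Real.rpow_le_rpow (Finset.prod_nonneg fun t _ => scaledRatio_nonneg h _) h1
    (by positivity)).trans (le_of_eq ?_)
  rw [one_div, Real.pow_rpow_inv_natCast hl hp.pos.ne']

lemma absR_apply (hA : ∀ i, 0 < A i i) (i j : Fin n) :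
    absR A i j = if j = i then 0 else |A i j| / A i i := by
  have hu : IsUnit A.diag := Pi.isUnit_iff.2 fun i => (hA i).ne'.isUnit
  have : Ring.inverse A.diag i = (A i i)⁻¹ :=
    eq_inv_of_mul_eq_one_left (congrFun (Ring.inverse_mul_cancel A.diag hu) i)
  rw [absR, Matrix.map_apply, Matrix.sub_apply, Matrix.inv_diagonal, Matrix.diagonal_mul, this]
  split_ifs with h
  · rw [h, Matrix.one_apply_eq, inv_mul_cancel₀ (hA i).ne', sub_self, abs_zero]
  · rw [Matrix.one_apply_ne' h, zero_sub, abs_neg, abs_mul, abs_inv, abs_of_pos (hA i),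
      inv_mul_eq_div]

lemma absR_mulVec_apply (hd : ∀ i, 0 < d i) (hA : ∀ i, 0 < A i i) (i : Fin n) :
    (absR A).mulVec d i = scaledRatio A d i * d i := by
  have hi := (hA i).ne'
  have hdi := (hd i).ne'
  have h1 : (absR A).mulVec d i
      = ∑ j ∈ Finset.univ.filter (fun j => j ≠ i), |A i j| * d j / A i i := by
    rw [Finset.sum_filter, Matrix.mulVec, dotProduct]
    refine Finset.sum_congr rfl fun j _ => ?_
    rw [absR_apply hA]
    split_ifs <;> simp_all [div_mul_eq_mul_div]
  rw [h1, ← Finset.sum_div, scaledRatio]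
  field_simp

lemma scaledRatio_le_of_mulVec_le (hd : ∀ i, 0 < d i) (hA : ∀ i, 0 < A i i) {l : ℝ}
    (h : ∀ i, (absR A).mulVec d i ≤ l * d i) (i : Fin n) : scaledRatio A d i ≤ l := by
  have := h i
  rw [absR_mulVec_apply hd hA] at this
  exact le_of_mul_le_mul_right this (hd i)

end Scaling

/-! ### Subinvariant vectors of nonnegative matrices -/

section Subinvariant

variable {n : ℕ} {B : Matrix (Fin n) (Fin n) ℝ}

attribute [local instance] Matrix.linftyOpNormedRing Matrix.linftyOpNormedAlgebra

/-- Gelfand's formula for the operator norm that is the maximal absolute row sum. -/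
lemma exists_sum_pow_le {r : ℝ} (hr : 0 < r)
    (h : spectralRadius ℂ (B.map (fun x : ℝ => (x : ℂ))) < ENNReal.ofReal r) :
    ∃ m : ℕ, 0 < m ∧ ∀ i, ∑ j, |(B ^ m) i j| ≤ r ^ m := by
  set c := B.map (fun x : ℝ => (x : ℂ)) with hc
  have h1 := (spectrum.pow_nnnorm_pow_one_div_tendsto_nhds_spectralRadius c).eventually_lt_const h
  obtain ⟨m, hm, hm0⟩ := (h1.and (Filter.eventually_gt_atTop 0)).exists
  refine ⟨m, hm0, fun i => ?_⟩
  have h2 : ‖c ^ m‖ ≤ r ^ m := by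
    have h3 := ENNReal.rpow_le_rpow hm.le (Nat.cast_nonneg m : (0 : ℝ) ≤ m)
    rw [← ENNReal.rpow_mul, one_div_mul_cancel (by positivity), ENNReal.rpow_one,
      ENNReal.rpow_natCast, ← ENNReal.ofReal_pow hr.le, ← enorm_eq_nnnorm, ← ofReal_norm,
      ENNReal.ofReal_le_ofReal_iff (by positivity)] at h3
    exact h3
  have h4 : c ^ m = (B ^ m).map (fun x : ℝ => (x : ℂ)) :=
    (Matrix.map_pow B (Complex.ofRealHom) m).symm
  have h5 : ∑ j, ‖(c ^ m) i j‖₊ ≤ ‖c ^ m‖₊ := by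
    rw [Matrix.linfty_opNNNorm_def]
    exact Finset.le_sup (f := fun i => ∑ j, ‖(c ^ m) i j‖₊) (Finset.mem_univ i)
  have h6 : ∑ j, ‖(c ^ m) i j‖ ≤ ‖c ^ m‖ := by
    simpa only [← NNReal.coe_le_coe, NNReal.coe_sum, coe_nnnorm] using h5
  refine le_trans (le_of_eq (Finset.sum_congr rfl fun j _ => ?_)) (h6.trans h2)
  rw [h4, Matrix.map_apply, Complex.norm_real, Real.norm_eq_abs]

/-- For `r` above the spectral radius, a truncated Neumann series gives a positive vector
that is subinvariant at level `r`. -/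
lemma exists_pos_mulVec_le (hB : ∀ i j, 0 ≤ B i j) {r : ℝ} (hr : 0 < r)
    (h : spectralRadius ℂ (B.map (fun x : ℝ => (x : ℂ))) < ENNReal.ofReal r) :
    ∃ d : Fin n → ℝ, (∀ i, 0 < d i) ∧ ∀ i, B.mulVec d i ≤ r * d i := by
  obtain ⟨m, hm0, hm⟩ := exists_sum_pow_le hr h
  have hpow : ∀ k i, (B ^ k).mulVec 1 i = ∑ j, (B ^ k) i j := fun k i => by
    simp [Matrix.mulVec, dotProduct]
  -- With `d = u 0 + ⋯ + u (m - 1)`, the relation `B u_k = r u_{k+1}` telescopes to `B d = r (d - u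
  -- 0 + u m)`, and `u m ≤ 1 = u 0`.
  let u : ℕ → Fin n → ℝ := fun k => (r ^ k)⁻¹ • (B ^ k).mulVec 1
  have hu : ∀ k i, 0 ≤ u k i := fun k i => by
    change 0 ≤ (r ^ k)⁻¹ * (B ^ k).mulVec 1 i
    rw [hpow]
    exact mul_nonneg (by positivity)
      (Finset.sum_nonneg fun j _ => Matrix.pow_apply_nonneg hB k i j)
  have hBu : ∀ k, B.mulVec (u k) = r • u (k + 1) := fun k => by
    simp only [u, Matrix.mulVec_smul, Matrix.mulVec_mulVec, smul_smul, ← pow_succ']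
    congr 1
    field_simp
    ring
  have hum : ∀ i, u m i ≤ 1 := fun i => by
    change (r ^ m)⁻¹ * (B ^ m).mulVec 1 i ≤ 1
    rw [inv_mul_le_iff₀ (by positivity), mul_one, hpow]
    exact (Finset.sum_le_sum fun j _ => le_abs_self _).trans (hm i)
  have hu0 : ∀ i, u 0 i = 1 := fun i => by simp [u]
  refine ⟨∑ k ∈ Finset.range m, u k, fun i => ?_, fun i => ?_⟩
  · rw [Finset.sum_apply]
    refine lt_of_lt_of_le ((hu0 i).symm ▸ one_pos) (Finset.single_le_sum
      (f := fun k => u k i) (fun k _ => hu k i) (Finset.mem_range.2 hm0))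
  · have h1 := Finset.sum_range_succ' (fun k => u k i) m
    rw [Finset.sum_range_succ] at h1
    rw [Matrix.mulVec_sum, Finset.sum_apply, Finset.sum_apply]
    simp only [hBu, Pi.smul_apply, smul_eq_mul, ← Finset.mul_sum]
    refine mul_le_mul_of_nonneg_left ?_ hr.le
    have h2 := hum i
    have h3 := hu0 i
    linarith

/-- At the spectral radius itself there is a nonzero nonnegative subinvariant vector. -/
lemma exists_mulVec_le_spectralRadius [NeZero n] (hB : ∀ i j, 0 ≤ B i j) {r : ℝ} (hr : 0 ≤ r)
    (h : spectralRadius ℂ (B.map (fun x : ℝ => (x : ℂ))) = ENNReal.ofReal r) :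
    ∃ d ∈ stdSimplex ℝ (Fin n), ∀ i, B.mulVec d i ≤ r * d i := by
  -- Normalising to the simplex supplies compactness and prevents the limit from being zero.
  have hex : ∀ k : ℕ, ∃ d ∈ stdSimplex ℝ (Fin n),
      ∀ i, B.mulVec d i ≤ (r + 1 / ((k : ℝ) + 1)) * d i := fun k => by
    have hlt : r < r + 1 / ((k : ℝ) + 1) := lt_add_of_pos_right _ (by positivity)
    obtain ⟨d, hd, hle⟩ := exists_pos_mulVec_le hB (hr.trans_lt hlt)
      (h.trans_lt ((ENNReal.ofReal_lt_ofReal_iff (hr.trans_lt hlt)).2 hlt))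
    have hs : 0 < ∑ i, d i := Finset.sum_pos (fun i _ => hd i) Finset.univ_nonempty
    refine ⟨(∑ i, d i)⁻¹ • d, ⟨fun i => ?_, ?_⟩, fun i => ?_⟩
    · exact mul_nonneg (by positivity) (hd i).le
    · simp only [Pi.smul_apply, smul_eq_mul, ← Finset.mul_sum]
      exact inv_mul_cancel₀ hs.ne'
    · have := mul_le_mul_of_nonneg_left (hle i) (inv_nonneg.2 hs.le)
      rw [Matrix.mulVec_smul]
      simp only [Pi.smul_apply, smul_eq_mul]
      linarith
  choose d hd hle using hex
  obtain ⟨a, ha, φ, hφ, hlim⟩ := (isCompact_stdSimplex ℝ (Fin n)).tendsto_subseq hd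
  refine ⟨a, ha, fun i => ?_⟩
  have hcont : Continuous fun v : Fin n → ℝ => B.mulVec v i := by
    simp only [Matrix.mulVec, dotProduct]
    fun_prop
  have h1 := (hcont.tendsto a).comp hlim
  have h2 : Filter.Tendsto (fun k : ℕ => r + 1 / ((φ k : ℝ) + 1)) Filter.atTop (nhds r) := by
    simpa using (tendsto_one_div_add_atTop_nhds_zero_nat.comp hφ.tendsto_atTop).const_add r
  exact le_of_tendsto_of_tendsto' h1 (h2.mul ((tendsto_pi_nhds.1 hlim) i)) fun k => hle (φ k) i

/-- Nonzero nonnegative subinvariant vectors of irreducible matrices are positive. -/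
lemma pos_of_isIrreducible (hB : B.IsIrreducible) {r : ℝ} {d : Fin n → ℝ}
    (hd : d ∈ stdSimplex ℝ (Fin n)) (hle : ∀ i, B.mulVec d i ≤ r * d i) (i : Fin n) :
    0 < d i := by
  refine (hd.1 i).lt_of_ne' fun h0 => ?_
  -- A zero spreads: if `d l = 0` then `(B d) l ≤ 0`, so `d j = 0` wherever `B l j > 0`.
  -- Irreducibility carries it to every index.
  have hz : ∀ k j, 0 < (B ^ k) i j → d j = 0 := by
    intro k
    induction k with
    | zero =>
      intro j hj
      rcases eq_or_ne i j with rfl | hij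
      · exact h0
      · simp [Matrix.one_apply_ne hij] at hj
    | succ k ih =>
      intro j hj
      rw [pow_succ, Matrix.mul_apply] at hj
      obtain ⟨l, -, hl⟩ := Finset.exists_lt_of_sum_lt (s := Finset.univ) (f := fun _ => (0 : ℝ))
        (by simpa using hj)
      have hl0 := Matrix.pow_apply_nonneg hB.nonneg k i l
      have hlj : 0 < B l j := pos_of_mul_pos_right hl hl0
      have hdl := ih l (pos_of_mul_pos_left hl hlj.le)
      have h1 : B l j * d j ≤ B.mulVec d l :=
        Finset.single_le_sum (f := fun t => B l t * d t)
          (fun t _ => mul_nonneg (hB.nonneg l t) (hd.1 t)) (Finset.mem_univ j)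
      have h2 := h1.trans (hle l)
      rw [hdl, mul_zero] at h2
      exact le_antisymm (nonpos_of_mul_nonpos_right h2 hlj) (hd.1 j)
  have hall : ∀ j, d j = 0 := fun j => by
    obtain ⟨k, -, hk⟩ := (Matrix.isIrreducible_iff_exists_pow_pos hB.nonneg).1 hB i j
    exact hz k j hk
  have := hd.2
  simp [hall] at this

end Subinvariant

theorem corollary2 {n : ℕ} (A : Matrix (Fin n) (Fin n) ℝ) (hA : IsGenDiagDominant A)
    (b : Fin n → ℝ) (N : Seminorm ℝ (Fin n → ℝ)) (hN : ∀ x, N x = 0 → x = 0)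
    (C : ℝ) (hC : 0 < C) :
    asymptoticRate A b N C ≤ loopGainBound A ∧
    loopGainBound A ≤ rhoR A ∧
    ((absR A).IsIrreducible → ∃ d : Fin n → ℝ, IsWeaklyScaledDD A d ∧ maxLoopGain A d ≤ rhoR A) := by
  obtain ⟨d, hd, hdom⟩ := hA
  have hdet := isUnit_det_of_isDiagDominant_scaled hdom
  have hrow := (isDiagDominant_scaled_iff hd).1 hdom
  have hpos : ∀ i, 0 < A i i := fun i => (hrow i).1
  have hdd := isWeaklyScaledDD_of_ratio_lt_one hd hpos fun i => (hrow i).2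
  have hgain : maxLoopGain A d ≤ 1 :=
    (maxLoopGain_le hdd fun i => (hrow i).2.le).trans_eq ENNReal.ofReal_one
  have hR : ∀ i j, 0 ≤ absR A i j := fun i j => abs_nonneg _
  have hx : A.mulVec (xStar A b) = b := by
    rw [xStar, Matrix.mulVec_mulVec, Matrix.mul_nonsing_inv _ hdet, Matrix.one_mulVec]
  refine ⟨le_iInf₂ fun d' hd' => asymptoticRate_le_maxLoopGain hd' hx N C, ?_, fun hirr => ?_⟩
  -- Above level `1` the given scaling suffices, since its ratios are below `1`. Below it, a
  -- subinvariant vector at level `t < 1` has all ratios below `1` and is therefore admissible.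
  · rcases le_or_gt 1 (rhoR A) with h1 | h1
    · exact (iInf₂_le d hdd).trans (hgain.trans h1)
    refine le_of_forall_gt_imp_ge_of_dense fun t ht => ?_
    rcases le_or_gt 1 t with h2 | h2
    · exact (iInf₂_le d hdd).trans (hgain.trans h2)
    have hfin : t ≠ ⊤ := (h2.trans ENNReal.one_lt_top).ne
    have ht0 : 0 < t.toReal := ENNReal.toReal_pos (ne_bot_of_gt ht) hfin
    obtain ⟨e, he, hle⟩ := exists_pos_mulVec_le hR ht0
      (ht.trans_eq (ENNReal.ofReal_toReal hfin).symm)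
    have hr := scaledRatio_le_of_mulVec_le he hpos hle
    have ht1 : t.toReal < 1 := by
      simpa using (ENNReal.toReal_lt_toReal hfin ENNReal.one_ne_top).2 h2
    have hde := isWeaklyScaledDD_of_ratio_lt_one he hpos fun i => (hr i).trans_lt ht1
    exact (iInf₂_le e hde).trans ((maxLoopGain_le hde hr).trans_eq (ENNReal.ofReal_toReal hfin))
  · rcases le_or_gt 1 (rhoR A) with h1 | h1
    · exact ⟨d, hdd, hgain.trans h1⟩
    -- The simplex is empty for `n = 0`.
    rcases eq_or_ne n 0 with rfl | hn
    · exact ⟨d, hdd, iSup_le fun i => i.elim0⟩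
    have : NeZero n := ⟨hn⟩
    have hfin : rhoR A ≠ ⊤ := (h1.trans ENNReal.one_lt_top).ne
    obtain ⟨e, he, hle⟩ := exists_mulVec_le_spectralRadius hR ENNReal.toReal_nonneg
      (ENNReal.ofReal_toReal hfin).symm
    have hepos := pos_of_isIrreducible hirr he hle
    have hr := scaledRatio_le_of_mulVec_le hepos hpos hle
    have ht1 : (rhoR A).toReal < 1 := by
      simpa using (ENNReal.toReal_lt_toReal hfin ENNReal.one_ne_top).2 h1
    have hde := isWeaklyScaledDD_of_ratio_lt_one hepos hpos fun i => (hr i).trans_lt ht1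
    exact ⟨e, hde, (maxLoopGain_le hde hr).trans_eq (ENNReal.ofReal_toReal hfin)⟩
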